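/- Let $1<p<\infty$, $R>0$, $\alpha\in\mathbb R\setminus\{0\}$, and let $w$ be a positive smooth function on $[0,R]$ with $w(0)=1$. For $0<r\le R$ consider the one-dimensional eigenvalue problem on $[0,r]$ $$ \begin{cases} (p-1)|\varphi'|^{p-2}\varphi''+\frac{w'}{w}|\varphi'|^{p-2}\varphi'=-\lambda|\varphi|^{p-2}\varphi,\\ |\varphi'(0)|^{p-2}\varphi'(0)=\alpha|\varphi(0)|^{p-2}\varphi(0),\\ \varphi'(r)=0, \end{cases} $$ understood in the weak sense: $\varphi\in W^{1,p}([0,r],w\,dt)$, $\varphi\not\equiv0$, and for all $\eta\in W^{1,p}([0,r],w\,dt)$ $$\int_0^r|\varphi'|^{p-2}\varphi'\,\eta'\,w\,dt+\alpha|\varphi(0)|^{p-2}\varphi(0)\,\eta(0)=\lambda\int_0^r|\varphi|^{p-2}\varphi\,\eta\,w\,dt,$$ where elements of $W^{1,p}$ are identified with their (absolutely) continuous representatives. Let $\bar\lambda_p([0,r],w,\alpha)$ be the first eigenvalue, that is, the smallest $\lambda$ for which there is such a $\varphi$. **Proposition 2.1.** For every $0<r\le R$ the first eigenvalue $\bar\lambda_p([0,r],w,\alpha)$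 exists and has an eigenfunction that is positive on $[0,r]$. Let $u$ be any first eigenfunction on $[0,R]$, associated to $\bar\lambda_p([0,R],w,\alpha)$, with $u>0$ on $[0,R]$. Then $u\in C^1([0,R])$ (with one-sided derivatives at the endpoints), and: 1. If $\alpha>0$, then $u'>0$ on $[0,R)$. 2. If $\alpha<0$, then $u'<0$ on $[0,R)$. 3. If $\alpha>0$ and $0<\bar R<R$, then $\bar\lambda_p([0,R],w,\alpha)<\bar\lambda_p([0,\bar R],w,\alpha)$. Assume further that $w$ is strictly log-concave, i.e. $(\log w)''<0$ on $[0,R)$. Then: 4. If $\alpha>0$, then $\frac{u'}{u}$ is monotone decreasing (non-increasing) on $[0,R]$, and $\left|\frac{u'}{u}\right|^{p-1}\le\alpha$ on $[0,R]$. 5. If $\alpha<0$, then $\frac{u'}{u}$ is monotone increasing (non-decreasing) on $[0,R]$, and $\left|\frac{u'}{u}\right|^{p-1}\le-\alpha$ on $[0,R]$. -/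

import Mathlib

open Set MeasureTheory
open scoped ContDiff

/-- The power nonlinearity `x ↦ |x|^{p-2} x` of the `p`-Laplacian (it vanishes at `x = 0`). -/
noncomputable def pPower (p x : ℝ) : ℝ := |x| ^ (p - 2) * x

/-- The weighted Sobolev space `W^{1,p}([0,R], w dt)` in dimension one: the absolutely continuous
functions on `[0,R]` whose (almost everywhere defined) derivative is `p`-integrable with respect
to `w dt`. The functions are identified with their continuous representatives, so that the value
at `0` makes sense; `∫ |u|^p w < ∞` is automatic because `u` and the weight are continuous. Only
the values of `u` on `[0,R]` matter. -/
def MemW1p (p R : ℝ) (w u : ℝ → ℝ) : Prop :=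
  AbsolutelyContinuousOnInterval u 0 R ∧
    IntervalIntegrable (fun t => |deriv u t| ^ p * w t) volume 0 R

/-- `u` is a (weak) eigenfunction, with eigenvalue `μ`, of the problem
`(w |u'|^{p-2} u')' = -μ w |u|^{p-2} u` on `[0,R]`, that is
`(p-1) |u'|^{p-2} u'' + (w'/w) |u'|^{p-2} u' = -μ |u|^{p-2} u`, with the Robin condition
`|u'(0)|^{p-2} u'(0) = α |u(0)|^{p-2} u(0)` and the Neumann condition `u'(R) = 0`. Both boundary
conditions are contained in the integral identity (the weight satisfies `w 0 = 1`). -/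
def IsEigenfunction (p R : ℝ) (w : ℝ → ℝ) (α μ : ℝ) (u : ℝ → ℝ) : Prop :=
  MemW1p p R w u ∧ (∃ t ∈ Icc 0 R, u t ≠ 0) ∧
    ∀ η : ℝ → ℝ, MemW1p p R w η →
      (∫ t in (0 : ℝ)..R, pPower p (deriv u t) * deriv η t * w t) + α * pPower p (u 0) * η 0
        = μ * ∫ t in (0 : ℝ)..R, pPower p (u t) * η t * w t

/-- The set of eigenvalues of the Robin--Neumann problem on `[0,R]`. -/
def eigenvalues (p R : ℝ) (w : ℝ → ℝ) (α : ℝ) : Set ℝ :=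
  {μ | ∃ u : ℝ → ℝ, IsEigenfunction p R w α μ u}

/-- The first eigenvalue: the smallest number for which the problem has a nontrivial weak
solution. -/
noncomputable def firstEigenvalue (p R : ℝ) (w : ℝ → ℝ) (α : ℝ) : ℝ :=
  sInf (eigenvalues p R w α)

/-- `u` is a positive first eigenfunction on `[0,R]`. -/
def IsPositiveFirstEigenfunction (p R : ℝ) (w : ℝ → ℝ) (α : ℝ) (u : ℝ → ℝ) : Prop :=
  IsEigenfunction p R w α (firstEigenvalue p R w α) u ∧ ∀ t ∈ Icc 0 R, 0 < u t

/-! Everything passes through a first-order equation. If `u > 0` is an eigenfunction with flux `V =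
w |u'|^{p-2} u'`, then `Y = V / u^{p-1}` satisfies the Riccati equation `Y' = -λ w - (p-1) w
|Y/w|^q`, where `q` is conjugate to `p`, with `Y 0 = α` and `Y R = 0`
(`IsEigenfunction.exists_riccati`). Conversely, such a `Y` integrates and exponentiates to a
positive eigenfunction (`exists_pos_isEigenfunction_of_riccati`). Existence is therefore a shooting
problem in `λ` for a scalar ODE (`exists_riccati`), and no variational argument is needed.

Minimality of this `λ` comes from Picone's inequality: for an eigenfunction `v` with eigenvalue `μ`
and flux `V`, the function `F = Y |v|^p - V v` starts at `0`, ends at `Y R |v R|^p`, and has `F' ≤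
(μ - λ) w |v|^p`. If `Y R ≥ 0`, then `μ < λ` is impossible; if `Y R > 0` and `v R ≠ 0`, even `μ ≤ λ`
is. The second case, applied to the Riccati solution of the long interval restricted to a shorter
one, gives the strict dependence on length.

The sign of `u'` is that of the flux, which is strictly monotone and vanishes at `R`. Finally `z = Y
/ w` solves `z' = -(log w)' z - λ - (p-1)|z|^q`. Strict log-concavity makes the coefficient of `z`
increasing, so a positive level of `|z|` cannot be crossed upwards and later downwards. Hence `|z| =
|u'/u|^{p-1}` decreases from its initial value `|α|`. -/

/-! ### The power nonlinearity. -/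

theorem abs_pPower {p : ℝ} (hp : 1 < p) (x : ℝ) : |pPower p x| = |x| ^ (p - 1) := by
  unfold pPower
  rcases eq_or_ne x 0 with rfl | hx
  · simp [Real.zero_rpow (by linarith : p - 1 ≠ 0)]
  · have hx' : 0 < |x| := abs_pos.2 hx
    rw [abs_mul, abs_of_nonneg (Real.rpow_nonneg hx'.le _), ← Real.rpow_add_one hx'.ne']
    congr 1; ring

theorem pPower_of_nonneg {p : ℝ} (hp : 1 < p) {x : ℝ} (hx : 0 ≤ x) :
    pPower p x = x ^ (p - 1) := by
  have h0 : 0 ≤ pPower p x := mul_nonneg (Real.rpow_nonneg (abs_nonneg _) _) hx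
  rw [← abs_of_nonneg h0, abs_pPower hp, abs_of_nonneg hx]

theorem pPower_neg (p x : ℝ) : pPower p (-x) = -pPower p x := by
  simp [pPower]

theorem pPower_zero (p : ℝ) : pPower p 0 = 0 := by simp [pPower]

theorem pPower_pos {p x : ℝ} (hx : 0 < x) : 0 < pPower p x :=
  mul_pos (Real.rpow_pos_of_pos (abs_pos.2 hx.ne') _) hx

theorem pPower_mul (p x y : ℝ) : pPower p (x * y) = pPower p x * pPower p y := by
  unfold pPower
  rw [abs_mul, Real.mul_rpow (abs_nonneg _) (abs_nonneg _)]
  ring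

theorem pPower_mul_self {p : ℝ} (hp : 1 < p) (x : ℝ) : pPower p x * x = |x| ^ p := by
  unfold pPower
  rcases eq_or_ne x 0 with rfl | hx
  · simp [Real.zero_rpow (by linarith : p ≠ 0)]
  · have hx' : 0 < |x| := abs_pos.2 hx
    rw [mul_assoc, ← abs_mul_abs_self, ← mul_assoc, ← Real.rpow_add_one hx'.ne',
      ← Real.rpow_add_one hx'.ne']
    congr 1; ring

theorem pPower_strictMono {p : ℝ} (hp : 1 < p) : StrictMono (pPower p) := by
  have key : ∀ x y : ℝ, 0 ≤ x → x < y → pPower p x < pPower p y := fun x y hx hxy => by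
    rw [pPower_of_nonneg hp hx, pPower_of_nonneg hp (hx.trans hxy.le)]
    exact Real.rpow_lt_rpow hx hxy (by linarith)
  intro x y hxy
  rcases le_or_gt 0 x with hx | hx
  · exact key x y hx hxy
  · rcases le_or_gt y 0 with hy | hy
    · have := key (-y) (-x) (by linarith) (by linarith)
      rw [pPower_neg, pPower_neg] at this
      linarith
    · have h1 := pPower_pos (p := p) (neg_pos.2 hx)
      have h2 := pPower_pos (p := p) hy
      rw [pPower_neg] at h1
      linarith

theorem continuous_pPower {p : ℝ} (hp : 1 < p) : Continuous (pPower p) := by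
  rw [continuous_iff_continuousAt]
  intro x
  rcases eq_or_ne x 0 with rfl | hx
  · rw [ContinuousAt, pPower_zero, tendsto_zero_iff_abs_tendsto_zero]
    have h : Filter.Tendsto (fun x : ℝ => |x| ^ (p - 1)) (nhds 0) (nhds 0) := by
      have : ContinuousAt (fun x : ℝ => |x| ^ (p - 1)) 0 :=
        continuous_abs.continuousAt.rpow_const (Or.inr (by linarith))
      simpa [ContinuousAt, Real.zero_rpow (by linarith : p - 1 ≠ 0)] using this
    exact h.congr fun x => (abs_pPower hp x).symm
  · exact (continuous_abs.continuousAt.rpow_const (Or.inl (by simpa using hx))).mul continuousAt_id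

theorem pPower_pPower {p q : ℝ} (hpq : p.HolderConjugate q) (x : ℝ) :
    pPower q (pPower p x) = x := by
  have key : ∀ x : ℝ, 0 ≤ x → pPower q (pPower p x) = x := fun x hx => by
    rw [pPower_of_nonneg hpq.lt hx, pPower_of_nonneg hpq.symm.lt (Real.rpow_nonneg hx _),
      ← Real.rpow_mul hx]
    have : (p - 1) * (q - 1) = 1 := by linear_combination hpq.sub_one_mul_conj
    rw [this, Real.rpow_one]
  rcases le_total 0 x with hx | hx
  · exact key x hx
  · have := key (-x) (by linarith)
    rw [pPower_neg, pPower_neg] at this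
    linarith

theorem hasDerivAt_abs_rpow_pPower {p : ℝ} (hp : 1 < p) (x : ℝ) :
    HasDerivAt (fun x : ℝ => |x| ^ p) (p * pPower p x) x := by
  convert hasDerivAt_abs_rpow x hp using 1
  simp [pPower, mul_assoc]

/-- Young's inequality in the form used for Picone's identity. -/
theorem young_pPower {p q : ℝ} (hpq : p.HolderConjugate q) (y v v' : ℝ) :
    p * y * pPower p v * v' ≤ |v'| ^ p + (p - 1) * |y| ^ q * |v| ^ p := by
  have h := Real.young_inequality_of_nonneg (abs_nonneg v')
    (mul_nonneg (abs_nonneg y) (abs_nonneg (pPower p v))) hpq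
  rw [Real.mul_rpow (abs_nonneg _) (abs_nonneg _), abs_pPower hpq.lt,
    ← Real.rpow_mul (abs_nonneg _), hpq.sub_one_mul_conj] at h
  have hp := hpq.pos
  have hq := hpq.symm.pos
  have h2 : y * pPower p v * v' ≤ |v'| * (|y| * |v| ^ (p - 1)) := by
    rw [← abs_pPower hpq.lt, ← abs_mul, ← abs_mul]
    exact (le_abs_self _).trans_eq (by congr 1; ring)
  have h3 : p / q = p - 1 := hpq.div_conj_eq_sub_one
  have h4 := mul_le_mul_of_nonneg_left (h2.trans h) hp.le
  have h5 : p * (|v'| ^ p / p + |y| ^ q * |v| ^ p / q)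
      = |v'| ^ p + (p / q) * |y| ^ q * |v| ^ p := by field_simp
  rw [h5, h3] at h4
  linarith

/-! ### Calculus on a compact interval. -/

theorem ae_mem_Ioo_of_mem_uIoc {a b : ℝ} (hab : a ≤ b) : ∀ᵐ t : ℝ, t ∈ uIoc a b → t ∈ Ioo a b := by
  have h : ∀ᵐ t : ℝ, t ≠ b := by simp [ae_iff, measure_singleton]
  filter_upwards [h] with t ht h'
  rw [uIoc_of_le hab] at h'
  exact ⟨h'.1, lt_of_le_of_ne h'.2 ht⟩

theorem ContinuousOn.hasDerivWithinAt_intervalIntegral {f : ℝ → ℝ} {a b : ℝ} (hab : a ≤ b)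
    (hf : ContinuousOn f (Icc a b)) {t : ℝ} (ht : t ∈ Icc a b) :
    HasDerivWithinAt (fun t => ∫ s in a..t, f s) (f t) (Icc a b) t := by
  -- Nothing is known about `f` outside the interval, so it is extended by its endpoint values
  -- before the fundamental theorem is applied.
  have hc : Continuous (IccExtend hab ((Icc a b).domRestrict f)) :=
    (continuousOn_iff_continuous_domRestrict.1 hf).Icc_extend'
  have he : ∀ s ∈ Icc a b, IccExtend hab ((Icc a b).domRestrict f) s = f s := fun s hs => by
    rw [IccExtend_of_mem hab _ hs, domRestrict_apply]
  have h := (hc.integral_hasStrictDerivAt a t).hasDerivAt.hasDerivWithinAt (s := Icc a b)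
  rw [he t ht] at h
  refine h.congr_of_mem (fun s hs => ?_) ht
  refine intervalIntegral.integral_congr fun x hx => ?_
  rw [uIcc_of_le hs.1] at hx
  exact (he x ⟨hx.1, hx.2.trans hs.2⟩).symm

theorem contDiffOn_one_of_hasDerivWithinAt {f f' : ℝ → ℝ} {a b : ℝ} (hab : a < b)
    (hf : ∀ t ∈ Icc a b, HasDerivWithinAt f (f' t) (Icc a b) t)
    (hf' : ContinuousOn f' (Icc a b)) : ContDiffOn ℝ 1 f (Icc a b) := by
  rw [show (1 : WithTop ℕ∞) = 0 + 1 by simp, contDiffOn_succ_iff_derivWithin (uniqueDiffOn_Icc hab)]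
  refine ⟨fun t ht => (hf t ht).differentiableWithinAt, by simp, ?_⟩
  rw [contDiffOn_zero]
  exact hf'.congr fun t ht => (hf t ht).derivWithin (uniqueDiffOn_Icc hab t ht)

theorem ae_deriv_eq_of_hasDerivWithinAt {f f' : ℝ → ℝ} {a b : ℝ} (hab : a ≤ b)
    (hf : ∀ t ∈ Icc a b, HasDerivWithinAt f (f' t) (Icc a b) t) :
    ∀ᵐ t : ℝ, t ∈ uIoc a b → deriv f t = f' t := by
  filter_upwards [ae_mem_Ioo_of_mem_uIoc hab] with t ht h
  have h' := ht h
  exact ((hf t ⟨h'.1.le, h'.2.le⟩).hasDerivAt (Icc_mem_nhds h'.1 h'.2)).deriv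

/-! ### Weak eigenfunctions and their flux. -/

/-- Regularity: an eigenfunction has a differentiable flux `V = w |u'|^{p-2} u'` for which the
equation and both boundary conditions hold pointwise. The weak equation is tested against a
primitive of the truncated defect `w |u'|^{p-2} u' - V`. -/
theorem IsEigenfunction.exists_flux {p q R α μ : ℝ} {w u : ℝ → ℝ} (hpq : p.HolderConjugate q)
    (hR : 0 < R) (hw : ContinuousOn w (Icc 0 R)) (hwpos : ∀ t ∈ Icc 0 R, 0 < w t)
    (hu : IsEigenfunction p R w α μ u) :
    ∃ V : ℝ → ℝ, V 0 = α * pPower p (u 0) ∧ V R = 0 ∧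
      (∀ t ∈ Icc 0 R, HasDerivWithinAt V (-(μ * (w t * pPower p (u t)))) (Icc 0 R) t) ∧
      ∀ t ∈ Icc 0 R, HasDerivWithinAt u (pPower q (V t / w t)) (Icc 0 R) t := by
  obtain ⟨⟨hac, hint⟩, -, hweak⟩ := hu
  have hp := hpq.lt
  have hI : uIcc 0 R = Icc 0 R := uIcc_of_le hR.le
  have hIoc : uIoc 0 R = Ioc 0 R := uIoc_of_le hR.le
  have huc : ContinuousOn u (Icc 0 R) := hI ▸ hac.continuousOn
  have hfc : ContinuousOn (fun t => w t * pPower p (u t)) (Icc 0 R) :=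
    hw.mul ((continuous_pPower hp).comp_continuousOn huc)
  have hwi : IntervalIntegrable w volume 0 R := (hI ▸ hw : ContinuousOn w (uIcc 0 R)).intervalIntegrable
  set V : ℝ → ℝ := fun t => α * pPower p (u 0) - μ * ∫ s in (0 : ℝ)..t, w s * pPower p (u s) with hV
  have hVd : ∀ t ∈ Icc 0 R, HasDerivWithinAt V (-(μ * (w t * pPower p (u t)))) (Icc 0 R) t :=
    fun t ht => ((hfc.hasDerivWithinAt_intervalIntegral hR.le ht).const_mul μ).const_sub _
  have hVac : AbsolutelyContinuousOnInterval V 0 R := by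
    apply ContDiffOn.absolutelyContinuousOnInterval
    rw [hI]
    exact contDiffOn_one_of_hasDerivWithinAt hR hVd (continuousOn_const.mul hfc).neg
  have hVc : ContinuousOn V (Icc 0 R) := hI ▸ hVac.continuousOn
  have hV0 : V 0 = α * pPower p (u 0) := by simp [hV]
  -- The constant test function `1` encodes the Neumann condition.
  have hVR : V R = 0 := by
    have h1 : MemW1p p R w fun _ => 1 :=
      ⟨contDiffOn_const.absolutelyContinuousOnInterval, by simp [Real.zero_rpow hpq.pos.ne']⟩
    have h2 := hweak _ h1
    simp only [deriv_const, mul_zero, zero_mul, intervalIntegral.integral_zero, mul_one,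
      zero_add] at h2
    simp only [hV]
    rw [h2]
    simp_rw [mul_comm (w _)]
    ring
  have hdm : AEStronglyMeasurable (fun t => pPower p (deriv u t) * w t)
      (volume.restrict (uIoc 0 R)) :=
    (((continuous_pPower hp).measurable.comp (measurable_deriv u)).aestronglyMeasurable).mul
      hwi.def'.aestronglyMeasurable
  have hWi : IntervalIntegrable (fun t => pPower p (deriv u t) * w t) volume 0 R := by
    refine (hwi.add hint).mono_fun hdm ?_
    refine (ae_restrict_iff' measurableSet_uIoc).2 (.of_forall fun t ht => ?_)
    rw [hIoc] at ht
    have hwt := hwpos t ⟨ht.1.le, ht.2⟩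
    beta_reduce
    rw [Real.norm_eq_abs, Real.norm_eq_abs, abs_mul, abs_pPower hp, abs_of_pos hwt]
    refine le_trans ?_ (le_abs_self _)
    have h1 : |deriv u t| ^ (p - 1) ≤ 1 + |deriv u t| ^ p := by
      rcases le_total |deriv u t| 1 with h | h
      · exact (Real.rpow_le_one (abs_nonneg _) h (by linarith)).trans
          (by linarith [Real.rpow_nonneg (abs_nonneg (deriv u t)) p])
      · linarith [Real.rpow_le_rpow_of_exponent_le h (by linarith : p - 1 ≤ p)]
    show _ ≤ w t + |deriv u t| ^ p * w t
    nlinarith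
  set D : ℝ → ℝ := fun t => pPower p (deriv u t) * w t - V t with hD
  have hDi : IntervalIntegrable D volume 0 R := hWi.sub hVac.continuousOn.intervalIntegrable
  -- Truncation at `±1` makes the test function admissible whatever the integrability of `D`, and it
  -- keeps the sign, so that `D * c D` vanishes only where `D` does.
  set c : ℝ → ℝ := fun x => max (-1) (min 1 x) with hcdef
  have hcc : Continuous c := continuous_const.max (continuous_const.min continuous_id)
  have hcb : ∀ x, |c x| ≤ 1 := fun x => by
    rw [abs_le]; exact ⟨le_max_left _ _, max_le (by norm_num) (min_le_left _ _)⟩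
  have hcm : AEStronglyMeasurable (fun t => c (D t)) (volume.restrict (uIoc 0 R)) :=
    hcc.comp_aestronglyMeasurable hDi.def'.aestronglyMeasurable
  have hφ : IntervalIntegrable (fun t => c (D t)) volume 0 R := by
    refine (intervalIntegrable_const (c := (1 : ℝ))).mono_fun hcm (.of_forall fun t => ?_)
    simpa using hcb (D t)
  set η : ℝ → ℝ := fun t => ∫ s in (0 : ℝ)..t, c (D s) with hη
  have hηac : AbsolutelyContinuousOnInterval η 0 R :=
    hφ.absolutelyContinuousOnInterval_intervalIntegral (by simp)
  have hηd : ∀ᵐ t : ℝ, t ∈ uIoc 0 R → deriv η t = c (D t) := by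
    filter_upwards [hφ.ae_hasDerivAt_integral] with t ht h
    exact (ht (uIoc_subset_uIcc h) 0 (by simp)).deriv
  have hηmem : MemW1p p R w η := by
    refine ⟨hηac, ?_⟩
    have h1 : IntervalIntegrable (fun t => |c (D t)| ^ p * w t) volume 0 R := by
      refine hwi.mono_fun (AEStronglyMeasurable.mul ?_ hwi.def'.aestronglyMeasurable)
        (.of_forall fun t => ?_)
      · exact (continuous_abs.rpow_const fun _ => Or.inr hpq.pos.le).comp_aestronglyMeasurable hcm
      · beta_reduce
        rw [norm_mul, Real.norm_of_nonneg (Real.rpow_nonneg (abs_nonneg _) _)]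
        exact mul_le_of_le_one_left (norm_nonneg _)
          (Real.rpow_le_one (abs_nonneg _) (hcb _) hpq.pos.le)
    refine h1.congr_ae ((ae_restrict_iff' measurableSet_uIoc).2 ?_)
    filter_upwards [hηd] with t ht h
    rw [ht h]
  -- Subtract the integration by parts of `V * deriv η` from the weak equation; the boundary terms
  -- drop out because `V R = 0` and `η 0 = 0`.
  have hzero : ∫ t in (0 : ℝ)..R, D t * c (D t) = 0 := by
    have e1 := hweak η hηmem
    have e2 := hVac.integral_mul_deriv_eq_deriv_mul hηac
    have e3 : ∫ t in (0 : ℝ)..R, deriv V t * η t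
        = -(μ * ∫ t in (0 : ℝ)..R, pPower p (u t) * η t * w t) := by
      rw [← intervalIntegral.integral_const_mul, ← intervalIntegral.integral_neg]
      refine intervalIntegral.integral_congr_ae ?_
      filter_upwards [ae_deriv_eq_of_hasDerivWithinAt hR.le hVd] with t ht h
      rw [ht h]; ring
    have e0 : η 0 = 0 := by simp [hη]
    rw [e3, hVR, e0] at e2
    rw [e0] at e1
    have i1 : IntervalIntegrable (fun t => pPower p (deriv u t) * deriv η t * w t) volume 0 R := by
      have : IntervalIntegrable (fun t => pPower p (deriv u t) * w t * c (D t)) volume 0 R := by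
        refine hWi.mono_fun (hdm.mul hcm) (.of_forall fun t => ?_)
        beta_reduce
        rw [norm_mul]
        exact mul_le_of_le_one_right (norm_nonneg _) (hcb _)
      refine this.congr_ae ((ae_restrict_iff' measurableSet_uIoc).2 ?_)
      filter_upwards [hηd] with t ht h
      rw [ht h]; ring
    have i2 : IntervalIntegrable (fun t => V t * deriv η t) volume 0 R :=
      hηac.intervalIntegrable_deriv.continuousOn_mul hVac.continuousOn
    have e4 : ∫ t in (0 : ℝ)..R, D t * c (D t)
        = ∫ t in (0 : ℝ)..R, (pPower p (deriv u t) * deriv η t * w t - V t * deriv η t) := by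
      refine intervalIntegral.integral_congr_ae ?_
      filter_upwards [hηd] with t ht h
      rw [ht h]; simp only [hD]; ring
    rw [e4, intervalIntegral.integral_sub i1 i2]
    linarith
  have hxc : ∀ x : ℝ, 0 ≤ x * c x ∧ (x * c x = 0 → x = 0) := fun x => by
    simp only [hcdef]
    rcases lt_trichotomy x 0 with h | h | h
    · have h1 : max (-1) (min 1 x) < 0 := max_lt (by norm_num) (min_lt_of_right_lt h)
      exact ⟨by nlinarith, fun h' => by nlinarith⟩
    · simp [h]
    · have h1 : 0 < max (-1) (min 1 x) := lt_max_of_lt_right (lt_min one_pos h)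
      exact ⟨by nlinarith, fun h' => by nlinarith⟩
  have hae : ∀ᵐ t : ℝ, t ∈ uIoc 0 R → D t = 0 := by
    have hDc : IntervalIntegrable (fun t => D t * c (D t)) volume 0 R := by
      refine hDi.mono_fun (hDi.def'.aestronglyMeasurable.mul hcm) (.of_forall fun t => ?_)
      beta_reduce
      rw [norm_mul]
      exact mul_le_of_le_one_right (norm_nonneg _) (hcb _)
    have := (intervalIntegral.integral_eq_zero_iff_of_le_of_nonneg_ae hR.le
      (.of_forall fun t => (hxc (D t)).1) hDc).1 hzero
    rw [Filter.EventuallyEq, ae_restrict_iff' measurableSet_Ioc] at this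
    rw [hIoc]
    filter_upwards [this] with t ht h
    exact (hxc _).2 (ht h)
  have hgc : ContinuousOn (fun t => pPower q (V t / w t)) (Icc 0 R) :=
    (continuous_pPower hpq.symm.lt).comp_continuousOn (hVc.div hw fun t ht => (hwpos t ht).ne')
  refine ⟨V, hV0, hVR, hVd, fun t ht => ?_⟩
  -- Inverting the power law shows that `deriv u` agrees a.e. with a continuous function; absolute
  -- continuity then makes `u` its primitive.
  have hue : ∀ s ∈ Icc 0 R, u s = u 0 + ∫ x in (0 : ℝ)..s, pPower q (V x / w x) := fun s hs => by
    have hsub : uIcc 0 s ⊆ uIcc 0 R := by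
      rw [uIcc_of_le hs.1, hI]; exact Icc_subset_Icc_right hs.2
    have h1 := (hac.mono hsub).integral_deriv_eq_sub
    have h2 : ∫ x in (0 : ℝ)..s, deriv u x = ∫ x in (0 : ℝ)..s, pPower q (V x / w x) := by
      refine intervalIntegral.integral_congr_ae ?_
      filter_upwards [hae] with x hx h
      rw [uIoc_of_le hs.1] at h
      have h' : x ∈ Ioc 0 R := ⟨h.1, h.2.trans hs.2⟩
      have h3 := hx (hIoc ▸ h')
      have h4 : V x / w x = pPower p (deriv u x) := by
        rw [div_eq_iff (hwpos x ⟨h'.1.le, h'.2⟩).ne']; simp only [hD] at h3; linarith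
      rw [h4, pPower_pPower hpq]
    linarith
  exact ((hgc.hasDerivWithinAt_intervalIntegral hR.le ht).const_add (u 0)).congr_of_mem hue ht

/-- A `C^1` function with `C^1` flux solving the equation pointwise is a weak eigenfunction. -/
theorem isEigenfunction_of_flux {p q R α μ : ℝ} {w u V : ℝ → ℝ} (hpq : p.HolderConjugate q)
    (hR : 0 < R) (hw : ContinuousOn w (Icc 0 R)) (hwpos : ∀ t ∈ Icc 0 R, 0 < w t)
    (hne : ∃ t ∈ Icc 0 R, u t ≠ 0)
    (hV0 : V 0 = α * pPower p (u 0)) (hVR : V R = 0)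
    (hV : ∀ t ∈ Icc 0 R, HasDerivWithinAt V (-(μ * (w t * pPower p (u t)))) (Icc 0 R) t)
    (hu : ∀ t ∈ Icc 0 R, HasDerivWithinAt u (pPower q (V t / w t)) (Icc 0 R) t) :
    IsEigenfunction p R w α μ u := by
  have hI : uIcc 0 R = Icc 0 R := uIcc_of_le hR.le
  have huc : ContinuousOn u (Icc 0 R) := fun t ht => (hu t ht).continuousWithinAt
  have hVc : ContinuousOn V (Icc 0 R) := fun t ht => (hV t ht).continuousWithinAt
  have hgc : ContinuousOn (fun t => pPower q (V t / w t)) (Icc 0 R) :=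
    (continuous_pPower hpq.symm.lt).comp_continuousOn (hVc.div hw fun t ht => (hwpos t ht).ne')
  have hfc : ContinuousOn (fun t => w t * pPower p (u t)) (Icc 0 R) :=
    hw.mul ((continuous_pPower hpq.lt).comp_continuousOn huc)
  have hud := ae_deriv_eq_of_hasDerivWithinAt hR.le hu
  have hVac : AbsolutelyContinuousOnInterval V 0 R := by
    apply ContDiffOn.absolutelyContinuousOnInterval
    rw [hI]
    exact contDiffOn_one_of_hasDerivWithinAt hR hV (continuousOn_const.mul hfc).neg
  refine ⟨⟨?_, ?_⟩, hne, fun η hη => ?_⟩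
  · apply ContDiffOn.absolutelyContinuousOnInterval
    rw [hI]
    exact contDiffOn_one_of_hasDerivWithinAt hR hu hgc
  · have h1 : IntervalIntegrable (fun t => |pPower q (V t / w t)| ^ p * w t) volume 0 R := by
      apply ContinuousOn.intervalIntegrable
      rw [hI]
      exact (hgc.abs.rpow_const fun _ _ => Or.inr hpq.pos.le).mul hw
    refine h1.congr_ae ((ae_restrict_iff' measurableSet_uIoc).2 ?_)
    filter_upwards [hud] with t ht h
    rw [ht h]
  · have e2 := hVac.integral_mul_deriv_eq_deriv_mul hη.1
    have e3 : ∫ t in (0 : ℝ)..R, deriv V t * η t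
        = -(μ * ∫ t in (0 : ℝ)..R, pPower p (u t) * η t * w t) := by
      rw [← intervalIntegral.integral_const_mul, ← intervalIntegral.integral_neg]
      refine intervalIntegral.integral_congr_ae ?_
      filter_upwards [ae_deriv_eq_of_hasDerivWithinAt hR.le hV] with t ht h
      rw [ht h]; ring
    have e4 : ∫ t in (0 : ℝ)..R, pPower p (deriv u t) * deriv η t * w t
        = ∫ t in (0 : ℝ)..R, V t * deriv η t := by
      refine intervalIntegral.integral_congr_ae ?_
      filter_upwards [hud, ae_mem_Ioo_of_mem_uIoc hR.le] with t ht h' h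
      have hwt := hwpos t (Ioo_subset_Icc_self (h' h))
      rw [ht h, pPower_pPower hpq.symm]
      field_simp
    rw [e3, hVR, hV0] at e2
    rw [e4, e2]
    ring

/-! ### Picone comparison of eigenvalues. -/

/-- **Picone's inequality.** A solution `Y` of the Riccati equation for the eigenvalue `lam`, compared
with an arbitrary eigenfunction `v` for an eigenvalue `μ`. -/
theorem IsEigenfunction.exists_picone {p q R α lam μ : ℝ} {w v Y : ℝ → ℝ}
    (hpq : p.HolderConjugate q) (hR : 0 < R) (hw : ContinuousOn w (Icc 0 R))
    (hwpos : ∀ t ∈ Icc 0 R, 0 < w t) (hv : IsEigenfunction p R w α μ v) (hY0 : Y 0 = α)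
    (hY : ∀ t ∈ Icc 0 R, HasDerivWithinAt Y
      (-lam * w t - (p - 1) * (w t * |Y t / w t| ^ q)) (Icc 0 R) t) :
    ∃ F F' : ℝ → ℝ, F 0 = 0 ∧ F R = Y R * |v R| ^ p ∧
      (∀ t ∈ Icc 0 R, HasDerivWithinAt F (F' t) (Icc 0 R) t) ∧
      ∀ t ∈ Icc 0 R, F' t ≤ (μ - lam) * (w t * |v t| ^ p) := by
  obtain ⟨V, hV0, hVR, hV, hvd⟩ := hv.exists_flux hpq hR hw hwpos
  refine ⟨fun t => Y t * |v t| ^ p - V t * v t, fun t => _, ?_, ?_, fun t ht =>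
    ((hY t ht).mul ((hasDerivAt_abs_rpow_pPower hpq.lt (v t)).comp_hasDerivWithinAt t
      (hvd t ht))).sub ((hV t ht).mul (hvd t ht)), fun t ht => ?_⟩
  · simp only [hY0, hV0, ← pPower_mul_self hpq.lt]; ring
  · simp [hVR]
  · have hwt := hwpos t ht
    -- Young's inequality bounds the cross term of `F'` by exactly the two terms that cancel against
    -- `V v' = w |v'|^p` and the nonlinear Riccati term.
    have h1 := young_pPower hpq (Y t / w t) (v t) (pPower q (V t / w t))
    have h2 : V t * pPower q (V t / w t) = w t * |pPower q (V t / w t)| ^ p := by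
      have h3 : V t = w t * pPower p (pPower q (V t / w t)) := by
        rw [pPower_pPower hpq.symm]; field_simp
      rw [← pPower_mul_self hpq.lt, ← mul_assoc, ← h3]
    have h4 : pPower p (v t) * v t = |v t| ^ p := pPower_mul_self hpq.lt _
    have h5 := mul_le_mul_of_nonneg_left h1 hwt.le
    have h6 : w t * (p * (Y t / w t) * pPower p (v t) * pPower q (V t / w t))
        = Y t * (p * pPower p (v t) * pPower q (V t / w t)) := by field_simp
    rw [h6] at h5
    simp only [Function.comp_apply]
    rw [h2]
    have h7 : -(μ * (w t * pPower p (v t))) * v t = -(μ * (w t * |v t| ^ p)) := by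
      rw [← h4]; ring
    rw [h7]
    nlinarith

theorem antitoneOn_Icc_of_hasDerivWithinAt_nonpos {f f' : ℝ → ℝ} {a b : ℝ}
    (hf : ∀ t ∈ Icc a b, HasDerivWithinAt f (f' t) (Icc a b) t)
    (hf' : ∀ t ∈ Icc a b, f' t ≤ 0) : AntitoneOn f (Icc a b) := by
  refine antitoneOn_of_hasDerivWithinAt_nonpos (f' := f') (convex_Icc a b)
    (fun t ht => (hf t ht).continuousWithinAt) (fun t ht => ?_) fun t ht => ?_
  · exact (hf t (interior_subset ht)).mono interior_subset
  · exact hf' t (interior_subset ht)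

/-- A Riccati solution vanishing at the right end belongs to the smallest eigenvalue. -/
theorem IsEigenfunction.le_of_riccati {p q R α lam μ : ℝ} {w v Y : ℝ → ℝ}
    (hpq : p.HolderConjugate q) (hR : 0 < R) (hw : ContinuousOn w (Icc 0 R))
    (hwpos : ∀ t ∈ Icc 0 R, 0 < w t) (hv : IsEigenfunction p R w α μ v) (hY0 : Y 0 = α)
    (hYR : 0 ≤ Y R)
    (hY : ∀ t ∈ Icc 0 R, HasDerivWithinAt Y
      (-lam * w t - (p - 1) * (w t * |Y t / w t| ^ q)) (Icc 0 R) t) : lam ≤ μ := by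
  by_contra! hlt
  obtain ⟨F, F', hF0, hFR, hF, hF'⟩ := hv.exists_picone hpq hR hw hwpos hY0 hY
  have hanti : AntitoneOn F (Icc 0 R) := by
    refine antitoneOn_Icc_of_hasDerivWithinAt_nonpos hF fun t ht => (hF' t ht).trans ?_
    have := mul_nonneg (hwpos t ht).le (Real.rpow_nonneg (abs_nonneg (v t)) p)
    nlinarith
  -- `F` is non-increasing from `0` to a nonnegative value, hence constant, whereas its derivative
  -- is negative wherever `v ≠ 0`.
  have h0 : ∀ t ∈ Icc 0 R, F t = 0 := fun t ht => by
    have h1 := hanti ⟨le_rfl, hR.le⟩ ht ht.1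
    have h2 := hanti ht ⟨hR.le, le_rfl⟩ ht.2
    have h3 := mul_nonneg hYR (Real.rpow_nonneg (abs_nonneg (v R)) p)
    linarith
  obtain ⟨t, ht, hvt⟩ := hv.2.1
  have h4 : F' t = 0 := (uniqueDiffOn_Icc hR t ht).eq_deriv _ (hF t ht)
    ((hasDerivWithinAt_const t _ (0 : ℝ)).congr_of_mem h0 ht)
  have h5 := hF' t ht
  have h6 := mul_pos (hwpos t ht) (Real.rpow_pos_of_pos (abs_pos.2 hvt) p)
  nlinarith

/-- With `μ ≤ lam`, the Picone function would be non-increasing yet rise from `0` to a positive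
value. -/
theorem IsEigenfunction.lt_of_riccati {p q R α lam μ : ℝ} {w v Y : ℝ → ℝ}
    (hpq : p.HolderConjugate q) (hR : 0 < R) (hw : ContinuousOn w (Icc 0 R))
    (hwpos : ∀ t ∈ Icc 0 R, 0 < w t) (hv : IsEigenfunction p R w α μ v) (hY0 : Y 0 = α)
    (hYR : 0 < Y R) (hvR : v R ≠ 0)
    (hY : ∀ t ∈ Icc 0 R, HasDerivWithinAt Y
      (-lam * w t - (p - 1) * (w t * |Y t / w t| ^ q)) (Icc 0 R) t) : lam < μ := by
  by_contra! hle
  obtain ⟨F, F', hF0, hFR, hF, hF'⟩ := hv.exists_picone hpq hR hw hwpos hY0 hY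
  have hanti : AntitoneOn F (Icc 0 R) := by
    refine antitoneOn_Icc_of_hasDerivWithinAt_nonpos hF fun t ht => (hF' t ht).trans ?_
    have := mul_nonneg (hwpos t ht).le (Real.rpow_nonneg (abs_nonneg (v t)) p)
    nlinarith
  have h1 := hanti ⟨le_rfl, hR.le⟩ ⟨hR.le, le_rfl⟩ hR.le
  have h3 := mul_pos hYR (Real.rpow_pos_of_pos (abs_pos.2 hvR) p)
  linarith

/-! ### Level crossings. -/

/-- The level sets of a solution of `z' = a(t) z + G(z)` with `a` strictly increasing are crossed
downwards only, if the solution vanishes at the right end. -/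
theorem antitoneOn_of_hasDerivWithinAt_mul_add {z a G : ℝ → ℝ} {R : ℝ}
    (hz : ∀ t ∈ Icc 0 R, HasDerivWithinAt z (a t * z t + G (z t)) (Icc 0 R) t)
    (hz0 : ∀ t ∈ Icc 0 R, 0 ≤ z t) (hzR : z R = 0) (ha : StrictMonoOn a (Icc 0 R)) :
    AntitoneOn z (Icc 0 R) := by
  intro t₁ ht₁ t₂ ht₂ h12
  by_contra! hlt
  obtain ⟨c, hc1, hc2⟩ := exists_between hlt
  have hc0 : 0 < c := (hz0 t₁ ht₁).trans_lt hc1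
  have hzc : ContinuousOn z (Icc 0 R) := fun t ht => (hz t ht).continuousWithinAt
  have hsub : Icc t₁ t₂ ⊆ Icc 0 R := Icc_subset_Icc ht₁.1 ht₂.2
  have hsub' : Icc t₂ R ⊆ Icc 0 R := Icc_subset_Icc_left ht₂.1
  -- The last point before `t₂` and the first point after it where `z ≤ c`; the latter exists
  -- because `z R = 0 < c`. In between `z > c`, so `z' ≥ 0` at `s` and `z' ≤ 0` at `s'`.
  obtain ⟨s, ⟨hs, hsc⟩, hsmax⟩ : ∃ s, IsGreatest (Icc t₁ t₂ ∩ z ⁻¹' Iic c) s := by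
    refine IsCompact.exists_isGreatest ?_ ⟨t₁, ⟨le_rfl, h12⟩, hc1.le⟩
    exact isCompact_Icc.of_isClosed_subset
      ((hzc.mono hsub).preimage_isClosed_of_isClosed isClosed_Icc isClosed_Iic) inter_subset_left
  obtain ⟨s', ⟨hs', hsc'⟩, hsmin⟩ : ∃ s, IsLeast (Icc t₂ R ∩ z ⁻¹' Iic c) s := by
    refine IsCompact.exists_isLeast ?_ ⟨R, ⟨ht₂.2, le_rfl⟩, by simpa [hzR] using hc0.le⟩
    exact isCompact_Icc.of_isClosed_subset
      ((hzc.mono hsub').preimage_isClosed_of_isClosed isClosed_Icc isClosed_Iic) inter_subset_left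
  simp only [mem_preimage, mem_Iic] at hsc hsc'
  have hst : s < t₂ := lt_of_le_of_ne hs.2 (by rintro rfl; linarith)
  have hst' : t₂ < s' := lt_of_le_of_ne hs'.1 (by rintro rfl; linarith)
  have habove : ∀ x ∈ Ioc s t₂, c < z x := fun x hx => by
    by_contra! h
    exact hx.1.not_ge (hsmax ⟨⟨hs.1.trans hx.1.le, hx.2⟩, h⟩)
  have habove' : ∀ x ∈ Ico t₂ s', c < z x := fun x hx => by
    by_contra! h
    exact hx.2.not_ge (hsmin ⟨⟨hx.1, hx.2.le.trans hs'.2⟩, h⟩)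
  have hsI := hsub hs
  have hsI' := hsub' hs'
  have ezs : z s = c := by
    refine le_antisymm hsc ?_
    have h1 : ContinuousWithinAt z (Ioc s t₂) s :=
      (hzc s hsI).mono (Ioc_subset_Icc_self.trans ((Icc_subset_Icc_left hs.1).trans hsub))
    have : (nhdsWithin s (Ioc s t₂)).NeBot := by
      rw [nhdsWithin_Ioc_eq_nhdsGT hst]; infer_instance
    exact ge_of_tendsto h1 (eventually_nhdsWithin_of_forall fun x hx => (habove x hx).le)
  have ezs' : z s' = c := by
    refine le_antisymm hsc' ?_
    have h1 : ContinuousWithinAt z (Ico t₂ s') s' :=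
      (hzc s' hsI').mono (Ico_subset_Icc_self.trans ((Icc_subset_Icc_right hs'.2).trans hsub'))
    have : (nhdsWithin s' (Ico t₂ s')).NeBot := by
      rw [nhdsWithin_Ico_eq_nhdsLT hst']; infer_instance
    exact ge_of_tendsto h1 (eventually_nhdsWithin_of_forall fun x hx => (habove' x hx).le)
  have hd : 0 ≤ a s * z s + G (z s) := by
    have h1 := ((hz s hsI).mono
      (Ioc_subset_Icc_self.trans ((Icc_subset_Icc_left hs.1).trans hsub) : Ioc s t₂ ⊆ _))
    rw [hasDerivWithinAt_iff_tendsto_slope' (by simp)] at h1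
    have : (nhdsWithin s (Ioc s t₂)).NeBot := by
      rw [nhdsWithin_Ioc_eq_nhdsGT hst]; infer_instance
    refine ge_of_tendsto h1 (eventually_nhdsWithin_of_forall fun x hx => ?_)
    rw [slope_def_field, ezs]
    exact div_nonneg (by linarith [habove x hx]) (by linarith [hx.1])
  have hd' : a s' * z s' + G (z s') ≤ 0 := by
    have h1 := ((hz s' hsI').mono
      (Ico_subset_Icc_self.trans ((Icc_subset_Icc_right hs'.2).trans hsub') : Ico t₂ s' ⊆ _))
    rw [hasDerivWithinAt_iff_tendsto_slope' (by simp)] at h1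
    have : (nhdsWithin s' (Ico t₂ s')).NeBot := by
      rw [nhdsWithin_Ico_eq_nhdsLT hst']; infer_instance
    refine le_of_tendsto h1 (eventually_nhdsWithin_of_forall fun x hx => ?_)
    rw [slope_def_field, ezs']
    exact div_nonpos_of_nonneg_of_nonpos (by linarith [habove' x hx]) (by linarith [hx.2])
  rw [ezs] at hd
  rw [ezs'] at hd'
  -- `a s * c + G c ≥ 0 ≥ a s' * c + G c` contradicts `a s < a s'` since `c > 0`.
  have := ha hsI hsI' (hst.trans hst')
  nlinarith

/-! ### Shooting for the Riccati equation. -/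

/-- A global bound allows a Picard–Lindelöf ball of radius `M * r`, so a single application covers
the interval and no continuation is needed. -/
theorem exists_hasDerivWithinAt_of_lipschitz_of_bounded {f : ℝ → ℝ → ℝ} {r : ℝ} {K M : NNReal}
    (hr : 0 ≤ r) (hf : ∀ t ∈ Icc 0 r, LipschitzWith K (f t))
    (hc : ∀ x, ContinuousOn (fun t => f t x) (Icc 0 r))
    (hM : ∀ t ∈ Icc 0 r, ∀ x, |f t x| ≤ M) (y₀ : ℝ) :
    ∃ Y : ℝ → ℝ, Y 0 = y₀ ∧ ∀ t ∈ Icc 0 r, HasDerivWithinAt Y (f t (Y t)) (Icc 0 r) t := by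
  have h : IsPicardLindelof f (⟨0, le_rfl, hr⟩ : Icc 0 r) y₀ (M * r.toNNReal) 0 M K :=
    { lipschitzOnWith := fun t ht => (hf t ht).lipschitzOnWith
      continuousOn := fun x _ => hc x
      norm_le := fun t ht x _ => hM t ht x
      mul_max_le := by simp [hr] }
  exact h.exists_eq_forall_mem_Icc_hasDerivWithinAt₀

theorem hasDerivWithinAt_Ici_of_Icc {Y : ℝ → ℝ} {y a b t : ℝ} (ht : t ∈ Ico a b)
    (h : HasDerivWithinAt Y y (Icc a b) t) : HasDerivWithinAt Y y (Ici t) t := by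
  refine (h.mono (Icc_subset_Icc_left ht.1)).mono_of_mem_nhdsWithin ?_
  exact Icc_mem_nhdsGE ht.2

/-- Shooting: the parameter `lam` can be adjusted so that the solution vanishes at `r`. -/
theorem exists_hasDerivWithinAt_eq_zero {w k g : ℝ → ℝ} {r y₀ l₁ l₂ B : ℝ} {C : NNReal}
    (hr : 0 ≤ r) (hl : l₁ ≤ l₂) (hw : ContinuousOn w (Icc 0 r)) (hk : ContinuousOn k (Icc 0 r))
    (hg : LipschitzWith C g) (hB : ∀ x, |g x| ≤ B)
    (h₁ : ∀ Y : ℝ → ℝ, Y 0 = y₀ → (∀ t ∈ Icc 0 r,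
      HasDerivWithinAt Y (-l₁ * w t - k t * g (Y t)) (Icc 0 r) t) → 0 ≤ Y r)
    (h₂ : ∀ Y : ℝ → ℝ, Y 0 = y₀ → (∀ t ∈ Icc 0 r,
      HasDerivWithinAt Y (-l₂ * w t - k t * g (Y t)) (Icc 0 r) t) → Y r ≤ 0) :
    ∃ lam ∈ Icc l₁ l₂, ∃ Y : ℝ → ℝ, Y 0 = y₀ ∧ Y r = 0 ∧ ∀ t ∈ Icc 0 r,
      HasDerivWithinAt Y (-lam * w t - k t * g (Y t)) (Icc 0 r) t := by
  obtain ⟨W, hW⟩ := isCompact_Icc.exists_bound_of_continuousOn hw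
  obtain ⟨k₁, hk₁⟩ := isCompact_Icc.exists_bound_of_continuousOn hk
  simp only [Real.norm_eq_abs] at hW hk₁
  have h0r : (0 : ℝ) ∈ Icc 0 r := ⟨le_rfl, hr⟩
  have hW0 : 0 ≤ W := (abs_nonneg _).trans (hW 0 h0r)
  have hk0 : 0 ≤ k₁ := (abs_nonneg _).trans (hk₁ 0 h0r)
  have hB0 : 0 ≤ B := (abs_nonneg _).trans (hB 0)
  have hlip : ∀ lam : ℝ, ∀ t ∈ Icc 0 r,
      LipschitzWith (k₁.toNNReal * C + 1) (fun x => -lam * w t - k t * g x) := fun lam t ht => by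
    refine LipschitzWith.of_dist_le_mul fun x y => ?_
    have h := hg.dist_le_mul x y
    rw [Real.dist_eq, Real.dist_eq] at *
    have e : -lam * w t - k t * g x - (-lam * w t - k t * g y) = -(k t * (g x - g y)) := by ring
    rw [e, abs_neg, abs_mul]
    push_cast
    rw [Real.coe_toNNReal _ hk0]
    calc |k t| * |g x - g y| ≤ k₁ * (C * |x - y|) :=
          mul_le_mul (hk₁ t ht) h (abs_nonneg _) hk0
      _ ≤ (k₁ * C + 1) * |x - y| := by nlinarith [abs_nonneg (x - y)]
  have hex : ∀ lam : ℝ, ∃ Y : ℝ → ℝ, Y 0 = y₀ ∧ ∀ t ∈ Icc 0 r,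
      HasDerivWithinAt Y (-lam * w t - k t * g (Y t)) (Icc 0 r) t := fun lam => by
    refine exists_hasDerivWithinAt_of_lipschitz_of_bounded
      (M := (|lam| * W + k₁ * B).toNNReal) hr (hlip lam)
      (fun x => (continuousOn_const.mul hw).sub (hk.mul continuousOn_const)) (fun t ht x => ?_) y₀
    rw [Real.coe_toNNReal _ (by positivity)]
    refine (abs_sub _ _).trans ?_
    rw [abs_mul, abs_mul, abs_neg]
    exact add_le_add (mul_le_mul_of_nonneg_left (hW t ht) (abs_nonneg _))
      (mul_le_mul (hk₁ t ht) (hB x) (abs_nonneg _) hk0)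
  choose Y hY0 hY using hex
  have hYc : ∀ lam, ContinuousOn (Y lam) (Icc 0 r) :=
    fun lam t ht => (hY lam t ht).continuousWithinAt
  have hK : ((k₁.toNNReal * C + 1 : NNReal) : ℝ) ≠ 0 := by positivity
  -- Grönwall: the trajectory for `b` solves the equation for `a` up to an error `W * |a - b|`, so
  -- the endpoint value is Lipschitz in the parameter.
  have hdist : ∀ a b : ℝ, dist (Y a r) (Y b r) ≤
      W / (k₁.toNNReal * C + 1 : NNReal) *
        (Real.exp ((k₁.toNNReal * C + 1 : NNReal) * r) - 1) * dist a b := fun a b => by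
    have h := dist_le_of_approx_trajectories_ODE_of_mem
      (v := fun t x => -a * w t - k t * g x) (s := fun _ => univ) (δ := 0) (εf := 0)
      (εg := W * dist a b)
      (fun t ht => (hlip a t (Ico_subset_Icc_self ht)).lipschitzOnWith) (hYc a)
      (fun t ht => hasDerivWithinAt_Ici_of_Icc ht (hY a t (Ico_subset_Icc_self ht)))
      (fun t _ => (dist_self _).le) (fun _ _ => trivial) (hYc b)
      (fun t ht => hasDerivWithinAt_Ici_of_Icc ht (hY b t (Ico_subset_Icc_self ht)))
      (fun t ht => by
        rw [Real.dist_eq, Real.dist_eq]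
        have e : -b * w t - k t * g (Y b t) - (-a * w t - k t * g (Y b t)) = w t * (a - b) := by
          ring
        rw [e, abs_mul]
        exact mul_le_mul_of_nonneg_right (hW t (Ico_subset_Icc_self ht)) (abs_nonneg _))
      (fun _ _ => trivial) (by simp [hY0]) r ⟨hr, le_rfl⟩
    rw [gronwallBound_of_K_ne_0 hK] at h
    refine h.trans_eq ?_
    simp only [sub_zero]
    ring
  have hcont : Continuous fun lam => Y lam r := by
    refine (LipschitzWith.of_dist_le_mul (K := (W / (k₁.toNNReal * C + 1 : NNReal) *
        (Real.exp ((k₁.toNNReal * C + 1 : NNReal) * r) - 1)).toNNReal) fun a b => ?_).continuous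
    rw [Real.coe_toNNReal]
    · exact hdist a b
    · have : 0 ≤ Real.exp ((k₁.toNNReal * C + 1 : NNReal) * r) - 1 :=
        sub_nonneg.2 (Real.one_le_exp (mul_nonneg (NNReal.coe_nonneg _) hr))
      positivity
  obtain ⟨lam, hlam, hz⟩ := intermediate_value_Icc' hl hcont.continuousOn
    ⟨h₂ _ (hY0 l₂) (hY l₂), h₁ _ (hY0 l₁) (hY l₁)⟩
  exact ⟨lam, hlam, Y lam, hY0 lam, hz, hY lam⟩

/-- The Riccati nonlinearity is neither bounded nor globally Lipschitz. It is clamped for the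
shooting; the solution found turns out to stay in the clamping interval. -/
theorem exists_lipschitzWith_clamp_abs_rpow {q : ℝ} (hq : 1 < q) {lo hi : ℝ} (h : lo < hi) :
    ∃ C : NNReal, ∃ B : ℝ, LipschitzWith C (fun x : ℝ => |max lo (min hi x)| ^ q) ∧
      ∀ x : ℝ, |(|max lo (min hi x)| ^ q)| ≤ B := by
  have h1 : ContDiffOn ℝ 1 (fun x : ℝ => |x| ^ q) (Icc lo hi) :=
    contDiffOn_one_of_hasDerivWithinAt h
      (fun t _ => (hasDerivAt_abs_rpow_pPower hq t).hasDerivWithinAt)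
      ((continuous_const.mul (continuous_pPower hq)).continuousOn)
  obtain ⟨C, hC⟩ := h1.exists_lipschitzOnWith (by decide) (convex_Icc _ _) isCompact_Icc
  obtain ⟨B, hB⟩ := isCompact_Icc.exists_bound_of_continuousOn h1.continuousOn
  have hmem : ∀ x, max lo (min hi x) ∈ Icc lo hi :=
    fun x => ⟨le_max_left _ _, max_le h.le (min_le_left _ _)⟩
  have hlip : LipschitzWith 1 (fun x : ℝ => max lo (min hi x)) :=
    (LipschitzWith.id.const_min hi).const_max lo
  refine ⟨C * 1, B, ?_, fun x => hB _ (hmem x)⟩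
  rw [← lipschitzOnWith_univ] at hlip ⊢
  exact hC.comp hlip fun x _ => hmem x

theorem exists_riccati_of_pos {q r α : ℝ} {w k : ℝ → ℝ} (hq : 1 < q) (hr : 0 < r) (hα : 0 < α)
    (hw : ContinuousOn w (Icc 0 r)) (hwpos : ∀ t ∈ Icc 0 r, 0 < w t)
    (hk : ContinuousOn k (Icc 0 r)) (hkpos : ∀ t ∈ Icc 0 r, 0 ≤ k t) :
    ∃ (lam : ℝ) (Y : ℝ → ℝ), Y 0 = α ∧ Y r = 0 ∧ ∀ t ∈ Icc 0 r,
      HasDerivWithinAt Y (-lam * w t - k t * |Y t| ^ q) (Icc 0 r) t := by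
  obtain ⟨C, B, hC, hB⟩ := exists_lipschitzWith_clamp_abs_rpow hq hα
  obtain ⟨t₀, ht₀, hmin⟩ := isCompact_Icc.exists_isMinOn (nonempty_Icc.2 hr.le) hw
  have hm := hwpos t₀ ht₀
  have hkg : ∀ t ∈ Icc 0 r, ∀ x : ℝ, 0 ≤ k t * |max 0 (min α x)| ^ q :=
    fun t ht x => mul_nonneg (hkpos t ht) (Real.rpow_nonneg (abs_nonneg _) _)
  -- With `lam = 0` the clamped term vanishes for `Y ≤ 0`, so the solution cannot become negative; a
  -- line of small positive slope supplies the strict barrier. The upper parameter forces `Y' ≤ -α /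
  -- r`.
  obtain ⟨lam, hlam, Y, hY0, hYr, hY⟩ := exists_hasDerivWithinAt_eq_zero (y₀ := α) (l₁ := 0)
    (l₂ := α / (w t₀ * r)) hr.le (by positivity) hw hk hC hB
    (fun Y hY0 hY => by
      by_contra! hneg
      have h := image_le_of_deriv_right_lt_deriv_boundary' (f := fun t => -Y t)
        (B := fun t => -Y r / (2 * r) * t) (B' := fun _ => -Y r / (2 * r) * 1)
        (fun t ht => (hY t ht).continuousWithinAt.neg)
        (fun t ht => (hasDerivWithinAt_Ici_of_Icc ht (hY t (Ico_subset_Icc_self ht))).neg)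
        (by simp [hY0, hα.le]) (by fun_prop)
        (fun t _ => ((hasDerivAt_id t).const_mul _).hasDerivWithinAt)
        (fun t ht he => by
          have h1 : 0 < -Y r / (2 * r) := div_pos (by linarith) (by linarith)
          have h2 : Y t ≤ 0 := by
            have := mul_nonneg h1.le ht.1
            linarith
          have h3 : max 0 (min α (Y t)) = 0 := max_eq_left (min_le_of_right_le h2)
          rw [h3, abs_zero, Real.zero_rpow (by linarith)]
          simpa using h1)
        (⟨hr.le, le_rfl⟩ : r ∈ Icc 0 r)
      have e : -Y r / (2 * r) * r = -Y r / 2 := by field_simp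
      simp only [e] at h
      linarith)
    (fun Y hY0 hY => by
      have hd : ∀ t ∈ Icc 0 r, HasDerivWithinAt (fun t => Y t + α / r * t) _ (Icc 0 r) t :=
        fun t ht => (hY t ht).add ((hasDerivAt_id t).const_mul (α / r)).hasDerivWithinAt
      have h := antitoneOn_Icc_of_hasDerivWithinAt_nonpos hd (fun t ht => by
        have h1 : w t₀ ≤ w t := hmin ht
        have h2 : α / (w t₀ * r) * w t₀ = α / r := by field_simp
        have h3 : α / (w t₀ * r) * w t₀ ≤ α / (w t₀ * r) * w t :=
          mul_le_mul_of_nonneg_left h1 (by positivity)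
        have := hkg t ht (Y t)
        linarith) ⟨le_rfl, hr.le⟩ ⟨hr.le, le_rfl⟩ hr.le
      have e : α / r * r = α := by field_simp
      simp only [e, hY0] at h
      linarith)
  refine ⟨lam, Y, hY0, hYr, fun t ht => ?_⟩
  -- Since `lam ≥ 0`, the solution decreases from `α` to `0` and the clamp is inactive.
  have hanti := antitoneOn_Icc_of_hasDerivWithinAt_nonpos hY fun t ht => by
    have h1 := mul_nonneg hlam.1 (hwpos t ht).le
    have := hkg t ht (Y t)
    linarith
  have h1 := hanti ⟨le_rfl, hr.le⟩ ht ht.1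
  have h2 := hanti ht ⟨hr.le, le_rfl⟩ ht.2
  rw [hY0] at h1
  rw [hYr] at h2
  have h3 := hY t ht
  rwa [min_eq_right h1, max_eq_right h2] at h3

theorem exists_riccati_of_neg {q r α : ℝ} {w k : ℝ → ℝ} (hq : 1 < q) (hr : 0 < r) (hα : α < 0)
    (hw : ContinuousOn w (Icc 0 r)) (hwpos : ∀ t ∈ Icc 0 r, 0 < w t)
    (hk : ContinuousOn k (Icc 0 r)) (hkpos : ∀ t ∈ Icc 0 r, 0 ≤ k t) :
    ∃ (lam : ℝ) (Y : ℝ → ℝ), Y 0 = α ∧ Y r = 0 ∧ ∀ t ∈ Icc 0 r,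
      HasDerivWithinAt Y (-lam * w t - k t * |Y t| ^ q) (Icc 0 r) t := by
  obtain ⟨t₀, ht₀, hmin⟩ := isCompact_Icc.exists_isMinOn (nonempty_Icc.2 hr.le) hw
  have hm := hwpos t₀ ht₀
  obtain ⟨W, hW⟩ := isCompact_Icc.exists_bound_of_continuousOn hw
  obtain ⟨k₁, hk₁⟩ := isCompact_Icc.exists_bound_of_continuousOn hk
  simp only [Real.norm_eq_abs] at hW hk₁
  have h0r : (0 : ℝ) ∈ Icc 0 r := ⟨le_rfl, hr.le⟩
  have hW0 : 0 ≤ W := (abs_nonneg _).trans (hW 0 h0r)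
  have hk0 : 0 ≤ k₁ := (abs_nonneg _).trans (hk₁ 0 h0r)
  have hαq : 0 ≤ |α| ^ q := Real.rpow_nonneg (abs_nonneg _) _
  -- With `lam = -L`, wherever `α ≤ Y ≤ 0` the slope of `Y` is at least `-α / r + 1`, so `Y` cannot
  -- fall below the line from `α` to `0`. The value `A` is the a priori bound from `Y' ≤ L * W` and
  -- `Y r = 0`, enlarged so that the barrier lies within the clamp.
  set L : ℝ := (k₁ * |α| ^ q + -α / r + 1) / w t₀ with hL
  have hαr : 0 < -α / r := div_pos (by linarith) hr
  have hL0 : 0 ≤ L := by positivity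
  set A : ℝ := max (L * W * r) (-α) with hA
  have hA0 : 0 < A := lt_max_of_lt_right (by linarith)
  obtain ⟨C, B, hC, hB⟩ := exists_lipschitzWith_clamp_abs_rpow hq (neg_lt_zero.2 hA0)
  have hkg : ∀ t ∈ Icc 0 r, ∀ x : ℝ, 0 ≤ k t * |max (-A) (min 0 x)| ^ q :=
    fun t ht x => mul_nonneg (hkpos t ht) (Real.rpow_nonneg (abs_nonneg _) _)
  obtain ⟨lam, hlam, Y, hY0, hYr, hY⟩ := exists_hasDerivWithinAt_eq_zero (y₀ := α) (l₁ := -L)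
    (l₂ := 0) hr.le (by linarith) hw hk hC hB
    (fun Y hY0 hY => by
      have h := image_le_of_deriv_right_lt_deriv_boundary' (f := fun t => -Y t)
        (B := fun t => -α + α / r * t) (B' := fun _ => α / r * 1)
        (fun t ht => (hY t ht).continuousWithinAt.neg)
        (fun t ht => (hasDerivWithinAt_Ici_of_Icc ht (hY t (Ico_subset_Icc_self ht))).neg)
        (by simp [hY0]) (by fun_prop)
        (fun t _ => (((hasDerivAt_id t).const_mul _).const_add _).hasDerivWithinAt)
        (fun t ht he => by
          have htI := Ico_subset_Icc_self ht
          have h1 : 0 ≤ -α / r * t := mul_nonneg hαr.le ht.1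
          have h2 : -α / r * t ≤ -α := by
            calc -α / r * t ≤ -α / r * r := mul_le_mul_of_nonneg_left ht.2.le hαr.le
              _ = -α := by field_simp
          have h3 : α / r = -(-α / r) := by ring
          rw [h3] at he ⊢
          have h4 : Y t ≤ 0 := by linarith
          have h5 : α ≤ Y t := by linarith
          have h6 : -A ≤ Y t := by linarith [le_max_right (L * W * r) (-α)]
          rw [min_eq_right h4, max_eq_right h6]
          have h7 : |Y t| ^ q ≤ |α| ^ q := by
            refine Real.rpow_le_rpow (abs_nonneg _) ?_ (by linarith)
            rw [abs_of_nonpos h4, abs_of_neg hα]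
            linarith
          have h8 : k t * |Y t| ^ q ≤ k₁ * |α| ^ q :=
            mul_le_mul ((le_abs_self _).trans (hk₁ t htI)) h7
              (Real.rpow_nonneg (abs_nonneg _) _) hk0
          have h9 : w t₀ ≤ w t := hmin htI
          have h10 : L * w t₀ = k₁ * |α| ^ q + -α / r + 1 := by rw [hL]; field_simp
          have h11 := mul_le_mul_of_nonneg_left h9 hL0
          linarith)
        (⟨hr.le, le_rfl⟩ : r ∈ Icc 0 r)
      have e : α / r * r = α := by field_simp
      simp only [e] at h
      linarith)
    (fun Y hY0 hY => by
      have h := antitoneOn_Icc_of_hasDerivWithinAt_nonpos hY (fun t ht => by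
        have := hkg t ht (Y t)
        linarith) ⟨le_rfl, hr.le⟩ ⟨hr.le, le_rfl⟩ hr.le
      linarith)
  refine ⟨lam, Y, hY0, hYr, fun t ht => ?_⟩
  have hlow : -A ≤ Y t := by
    have hd : ∀ t ∈ Icc 0 r, HasDerivWithinAt (fun t => Y t - L * W * t) _ (Icc 0 r) t :=
      fun t ht => (hY t ht).sub ((hasDerivAt_id t).const_mul (L * W)).hasDerivWithinAt
    have h := antitoneOn_Icc_of_hasDerivWithinAt_nonpos hd (fun t ht => by
      have h1 := (le_abs_self _).trans (hW t ht)
      have h2 : -lam * w t ≤ L * W :=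
        mul_le_mul (by linarith [hlam.1]) h1 (hwpos t ht).le hL0
      have := hkg t ht (Y t)
      linarith) ht ⟨hr.le, le_rfl⟩ ht.2
    simp only [hYr] at h
    have h1 : 0 ≤ L * W * t := mul_nonneg (mul_nonneg hL0 hW0) ht.1
    linarith [le_max_left (L * W * r) (-α)]
  -- Above `0` the clamped term vanishes and `Y' = -lam * w ≥ 0`, so a positive solution could not
  -- return to `0` at `r`.
  have hup : Y t ≤ 0 := by
    by_contra! hpos
    have hsub : Icc t r ⊆ Icc 0 r := Icc_subset_Icc_left ht.1
    have hε : 0 < Y t / (2 * r) := by positivity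
    have h := image_le_of_deriv_right_lt_deriv_boundary' (f := fun s => -Y s) (a := t) (b := r)
      (B := fun s => -Y t + Y t / (2 * r) * (s - t)) (B' := fun _ => Y t / (2 * r) * 1)
      (fun s hs => ((hY s (hsub hs)).continuousWithinAt.mono hsub).neg)
      (fun s hs => (hasDerivWithinAt_Ici_of_Icc hs
        ((hY s (hsub (Ico_subset_Icc_self hs))).mono hsub)).neg)
      (by simp) (by fun_prop)
      (fun s _ => ((((hasDerivAt_id s).sub_const t).const_mul _).const_add _).hasDerivWithinAt)
      (fun s hs he => by
        have h1 : Y t / (2 * r) * (s - t) ≤ Y t / (2 * r) * r :=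
          mul_le_mul_of_nonneg_left (by linarith [hs.2, ht.1]) hε.le
        have h2 : Y t / (2 * r) * r = Y t / 2 := by field_simp
        have h3 : 0 ≤ Y s := by linarith
        rw [min_eq_left h3, max_eq_right (by linarith), abs_zero, Real.zero_rpow (by linarith)]
        have h4 := mul_nonneg (neg_nonneg.2 hlam.2) (hwpos s (hsub (Ico_subset_Icc_self hs))).le
        linarith)
      (⟨ht.2, le_rfl⟩ : r ∈ Icc t r)
    have h1 : Y t / (2 * r) * (r - t) ≤ Y t / (2 * r) * r :=
      mul_le_mul_of_nonneg_left (by linarith [ht.1]) hε.le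
    have h2 : Y t / (2 * r) * r = Y t / 2 := by field_simp
    simp only [hYr] at h
    linarith
  have h3 := hY t ht
  rwa [min_eq_right hup, max_eq_right hlow] at h3

theorem exists_riccati {p q r α : ℝ} {w : ℝ → ℝ} (hpq : p.HolderConjugate q) (hr : 0 < r)
    (hα : α ≠ 0) (hw : ContinuousOn w (Icc 0 r)) (hwpos : ∀ t ∈ Icc 0 r, 0 < w t) :
    ∃ (lam : ℝ) (Y : ℝ → ℝ), Y 0 = α ∧ Y r = 0 ∧ ∀ t ∈ Icc 0 r,
      HasDerivWithinAt Y (-lam * w t - (p - 1) * (w t * |Y t / w t| ^ q)) (Icc 0 r) t := by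
  have hk : ContinuousOn (fun t => (p - 1) * (w t / w t ^ q)) (Icc 0 r) :=
    continuousOn_const.mul (hw.div (hw.rpow_const fun t ht => Or.inl (hwpos t ht).ne')
      fun t ht => (Real.rpow_pos_of_pos (hwpos t ht) q).ne')
  have hk0 : ∀ t ∈ Icc 0 r, 0 ≤ (p - 1) * (w t / w t ^ q) := fun t ht =>
    mul_nonneg hpq.sub_one_pos.le
      (div_nonneg (hwpos t ht).le (Real.rpow_nonneg (hwpos t ht).le _))
  have key : ∃ (lam : ℝ) (Y : ℝ → ℝ), Y 0 = α ∧ Y r = 0 ∧ ∀ t ∈ Icc 0 r,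
      HasDerivWithinAt Y (-lam * w t - (p - 1) * (w t / w t ^ q) * |Y t| ^ q) (Icc 0 r) t := by
    rcases hα.lt_or_gt with h | h
    · exact exists_riccati_of_neg hpq.symm.lt hr h hw hwpos hk hk0
    · exact exists_riccati_of_pos hpq.symm.lt hr h hw hwpos hk hk0
  obtain ⟨lam, Y, hY0, hYr, hY⟩ := key
  refine ⟨lam, Y, hY0, hYr, fun t ht => ?_⟩
  convert hY t ht using 2
  rw [abs_div, abs_of_pos (hwpos t ht), Real.div_rpow (abs_nonneg _) (hwpos t ht).le]
  ring

/-! ### Riccati solutions and positive eigenfunctions. -/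

theorem hasDerivAt_pPower_of_pos {p : ℝ} (hp : 1 < p) {x : ℝ} (hx : 0 < x) :
    HasDerivAt (pPower p) ((p - 1) * (pPower p x / x)) x := by
  have h := Real.hasDerivAt_rpow_const (p := p - 1) (Or.inl hx.ne')
  have e : pPower p =ᶠ[nhds x] fun y => y ^ (p - 1) := by
    filter_upwards [lt_mem_nhds hx] with y hy
    exact pPower_of_nonneg hp hy.le
  rw [pPower_of_nonneg hp hx.le, ← Real.rpow_sub_one hx.ne']
  exact h.congr_of_eventuallyEq e

/-- Exponentiating the primitive of a Riccati solution gives a positive eigenfunction. -/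
theorem exists_pos_isEigenfunction_of_riccati {p q r α lam : ℝ} {w Y : ℝ → ℝ}
    (hpq : p.HolderConjugate q) (hr : 0 < r) (hw : ContinuousOn w (Icc 0 r))
    (hwpos : ∀ t ∈ Icc 0 r, 0 < w t) (hY0 : Y 0 = α) (hYr : Y r = 0)
    (hY : ∀ t ∈ Icc 0 r, HasDerivWithinAt Y
      (-lam * w t - (p - 1) * (w t * |Y t / w t| ^ q)) (Icc 0 r) t) :
    ∃ u : ℝ → ℝ, IsEigenfunction p r w α lam u ∧ ∀ t, 0 < u t := by
  have hp := hpq.lt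
  have hYc : ContinuousOn Y (Icc 0 r) := fun t ht => (hY t ht).continuousWithinAt
  have hφ : ContinuousOn (fun t => pPower q (Y t / w t)) (Icc 0 r) :=
    (continuous_pPower hpq.symm.lt).comp_continuousOn (hYc.div hw fun t ht => (hwpos t ht).ne')
  set u : ℝ → ℝ := fun t => Real.exp (∫ s in (0 : ℝ)..t, pPower q (Y s / w s)) with hu
  have hupos : ∀ t, 0 < u t := fun t => Real.exp_pos _
  have hud : ∀ t ∈ Icc 0 r, HasDerivWithinAt u (u t * pPower q (Y t / w t)) (Icc 0 r) t :=
    fun t ht => (hφ.hasDerivWithinAt_intervalIntegral hr.le ht).exp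
  refine ⟨u, isEigenfunction_of_flux (V := fun t => Y t * pPower p (u t)) hpq hr hw hwpos
    ⟨0, ⟨le_rfl, hr.le⟩, (hupos 0).ne'⟩ (by rw [hY0]) (by rw [hYr, zero_mul])
    (fun t ht => ?_) (fun t ht => ?_), hupos⟩
  · refine ((hY t ht).mul ((hasDerivAt_pPower_of_pos hp (hupos t)).comp_hasDerivWithinAt t
      (hud t ht))).congr_deriv ?_
    have hwt := (hwpos t ht).ne'
    have hut := (hupos t).ne'
    have e : |Y t / w t| ^ q = pPower q (Y t / w t) * (Y t / w t) :=
      (pPower_mul_self hpq.symm.lt _).symm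
    rw [e]
    simp only [Function.comp_apply]
    field_simp
    ring
  · convert hud t ht using 1
    rw [mul_div_right_comm, pPower_mul, pPower_pPower hpq, mul_comm]

/-- The logarithmic derivative of a positive eigenfunction solves the Riccati equation. -/
theorem IsEigenfunction.exists_riccati {p q R α μ : ℝ} {w u : ℝ → ℝ} (hpq : p.HolderConjugate q)
    (hR : 0 < R) (hw : ContinuousOn w (Icc 0 R)) (hwpos : ∀ t ∈ Icc 0 R, 0 < w t)
    (hu : IsEigenfunction p R w α μ u) (hupos : ∀ t ∈ Icc 0 R, 0 < u t) :
    ∃ Y : ℝ → ℝ, Y 0 = α ∧ Y R = 0 ∧ (0 < α → ∀ t ∈ Ico 0 R, 0 < Y t) ∧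
      (α < 0 → ∀ t ∈ Ico 0 R, Y t < 0) ∧
      (∀ t ∈ Icc 0 R, HasDerivWithinAt Y
        (-μ * w t - (p - 1) * (w t * |Y t / w t| ^ q)) (Icc 0 R) t) ∧
      ∀ t ∈ Icc 0 R, HasDerivWithinAt u (u t * pPower q (Y t / w t)) (Icc 0 R) t := by
  obtain ⟨V, hV0, hVR, hV, hud⟩ := hu.exists_flux hpq hR hw hwpos
  have hp := hpq.lt
  have h0 : (0 : ℝ) ∈ Icc 0 R := ⟨le_rfl, hR.le⟩
  have hP : ∀ t ∈ Icc 0 R, 0 < pPower p (u t) := fun t ht => pPower_pos (hupos t ht)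
  have hVc : ContinuousOn V (Icc 0 R) := fun t ht => (hV t ht).continuousWithinAt
  -- A `μ` of the wrong sign (or zero) would move `V` away from `0`, or leave it constant,
  -- contradicting `V R = 0`; with the right sign `V` is strictly monotone and vanishes only at `R`.
  have hsign : (0 < α → ∀ t ∈ Ico 0 R, 0 < V t) ∧ (α < 0 → ∀ t ∈ Ico 0 R, V t < 0) := by
    have hint : ∀ t ∈ interior (Icc 0 R), t ∈ Icc 0 R := fun t ht => interior_subset ht
    refine ⟨fun hα t ht => ?_, fun hα t ht => ?_⟩
    · have hμ : 0 < μ := by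
        by_contra! hμ
        have hm := monotoneOn_of_hasDerivWithinAt_nonneg (convex_Icc 0 R) hVc
          (fun t ht => (hV t (hint t ht)).mono interior_subset) (fun t ht => by
            have := mul_pos (hwpos t (hint t ht)) (hP t (hint t ht))
            nlinarith) h0 ⟨hR.le, le_rfl⟩ hR.le
        have := mul_pos hα (hP 0 h0)
        linarith
      have hm := strictAntiOn_of_hasDerivWithinAt_neg (convex_Icc 0 R) hVc
          (fun t ht => (hV t (hint t ht)).mono interior_subset) (fun t ht => by
            have := mul_pos (hwpos t (hint t ht)) (hP t (hint t ht))
            nlinarith) (Ico_subset_Icc_self ht) ⟨hR.le, le_rfl⟩ ht.2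
      linarith
    · have hμ : μ < 0 := by
        by_contra! hμ
        have hm := antitoneOn_of_hasDerivWithinAt_nonpos (convex_Icc 0 R) hVc
          (fun t ht => (hV t (hint t ht)).mono interior_subset) (fun t ht => by
            have := mul_pos (hwpos t (hint t ht)) (hP t (hint t ht))
            nlinarith) h0 ⟨hR.le, le_rfl⟩ hR.le
        have := mul_neg_of_neg_of_pos hα (hP 0 h0)
        linarith
      have hm := strictMonoOn_of_hasDerivWithinAt_pos (convex_Icc 0 R) hVc
          (fun t ht => (hV t (hint t ht)).mono interior_subset) (fun t ht => by
            have := mul_pos (hwpos t (hint t ht)) (hP t (hint t ht))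
            nlinarith) (Ico_subset_Icc_self ht) ⟨hR.le, le_rfl⟩ ht.2
      linarith
  have hφ : ∀ t ∈ Icc 0 R,
      pPower q (V t / w t) = u t * pPower q (V t / pPower p (u t) / w t) := fun t ht => by
    have hPt := (hP t ht).ne'
    rw [← pPower_pPower hpq (u t), ← pPower_mul, pPower_pPower hpq]
    congr 1
    field_simp
  refine ⟨fun t => V t / pPower p (u t), ?_, by simp [hVR], fun hα t ht => ?_,
    fun hα t ht => ?_, fun t ht => ?_, fun t ht => ?_⟩
  · beta_reduce
    rw [hV0, mul_div_assoc, div_self (hP 0 h0).ne', mul_one]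
  · exact div_pos (hsign.1 hα t ht) (hP t (Ico_subset_Icc_self ht))
  · exact div_neg_of_neg_of_pos (hsign.2 hα t ht) (hP t (Ico_subset_Icc_self ht))
  · have hwt := (hwpos t ht).ne'
    have hut := (hupos t ht).ne'
    have hPt := (hP t ht).ne'
    have e : |V t / pPower p (u t) / w t| ^ q
        = pPower q (V t / pPower p (u t) / w t) * (V t / pPower p (u t) / w t) :=
      (pPower_mul_self hpq.symm.lt _).symm
    refine ((hV t ht).div ((hasDerivAt_pPower_of_pos hp (hupos t ht)).comp_hasDerivWithinAt t
      (hud t ht)) hPt).congr_deriv ?_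
    rw [hφ t ht, e]
    simp only [Function.comp_apply]
    generalize pPower q (V t / pPower p (u t) / w t) = z
    field_simp
  · rw [← hφ t ht]
    exact hud t ht

/-! ### The log-concave weight. -/

/-- The Riccati equation for `Y / w` in terms of the logarithmic derivative of the weight. -/
theorem hasDerivWithinAt_div_weight {p q R lam : ℝ} {w Y : ℝ → ℝ} (hR : 0 < R)
    (hw : DifferentiableOn ℝ w (Icc 0 R)) (hwpos : ∀ t ∈ Icc 0 R, 0 < w t)
    (hY : ∀ t ∈ Icc 0 R, HasDerivWithinAt Y
      (-lam * w t - (p - 1) * (w t * |Y t / w t| ^ q)) (Icc 0 R) t) {t : ℝ} (ht : t ∈ Icc 0 R) :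
    HasDerivWithinAt (fun t => Y t / w t)
      (-derivWithin (fun s => Real.log (w s)) (Icc 0 R) t * (Y t / w t)
        + (-lam - (p - 1) * |Y t / w t| ^ q)) (Icc 0 R) t := by
  have hwt := (hwpos t ht).ne'
  have hwd := (hw t ht).hasDerivWithinAt
  have hlog : derivWithin (fun s => Real.log (w s)) (Icc 0 R) t
      = derivWithin w (Icc 0 R) t / w t :=
    (hwd.log hwt).derivWithin (uniqueDiffOn_Icc hR t ht)
  refine ((hY t ht).div hwd hwt).congr_deriv ?_
  rw [hlog]
  generalize |Y t / w t| ^ q = z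
  field_simp
  ring

theorem strictMonoOn_neg_derivWithin_log {R : ℝ} {w : ℝ → ℝ} (hR : 0 < R)
    (hw : ContDiffOn ℝ ∞ w (Icc 0 R)) (hwpos : ∀ t ∈ Icc 0 R, 0 < w t)
    (h : ∀ t ∈ Ico 0 R, iteratedDerivWithin 2 (fun s => Real.log (w s)) (Icc 0 R) t < 0) :
    StrictMonoOn (fun t => -derivWithin (fun s => Real.log (w s)) (Icc 0 R) t) (Icc 0 R) := by
  have hL : ContDiffOn ℝ ∞ (fun s => Real.log (w s)) (Icc 0 R) :=
    hw.log fun t ht => (hwpos t ht).ne'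
  have hanti : StrictAntiOn (derivWithin (fun s => Real.log (w s)) (Icc 0 R)) (Icc 0 R) := by
    refine strictAntiOn_of_deriv_neg (convex_Icc 0 R)
      (hL.continuousOn_derivWithin (uniqueDiffOn_Icc hR) (by simp)) fun t ht => ?_
    rw [interior_Icc] at ht
    have h1 := h t (Ioo_subset_Ico_self ht)
    rw [iteratedDerivWithin_succ, iteratedDerivWithin_one,
      derivWithin_of_mem_nhds (Icc_mem_nhds ht.1 ht.2)] at h1
    exact h1
  exact fun a ha b hb hab => neg_lt_neg (hanti ha hb hab)

/-! ### Assembly. -/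

/-- One Riccati solution does both jobs: it produces the positive eigenfunction and, by Picone,
bounds every other eigenvalue from below. -/
theorem isLeast_firstEigenvalue_and_exists_pos {p r α : ℝ} {w : ℝ → ℝ} (hp : 1 < p) (hr : 0 < r)
    (hα : α ≠ 0) (hw : ContinuousOn w (Icc 0 r)) (hwpos : ∀ t ∈ Icc 0 r, 0 < w t) :
    IsLeast (eigenvalues p r w α) (firstEigenvalue p r w α) ∧
      ∃ u : ℝ → ℝ, IsPositiveFirstEigenfunction p r w α u := by
  have hpq := Real.HolderConjugate.conjExponent hp
  obtain ⟨lam, Y, hY0, hYr, hY⟩ := exists_riccati hpq hr hα hw hwpos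
  obtain ⟨u, hu, hupos⟩ := exists_pos_isEigenfunction_of_riccati hpq hr hw hwpos hY0 hYr hY
  have hleast : IsLeast (eigenvalues p r w α) lam :=
    ⟨⟨u, hu⟩, fun μ ⟨v, hv⟩ => hv.le_of_riccati hpq hr hw hwpos hY0 hYr.ge hY⟩
  have he : firstEigenvalue p r w α = lam := hleast.csInf_eq
  exact ⟨he.symm ▸ hleast, u, he.symm ▸ hu, fun t _ => hupos t⟩

theorem proposition2p1 (p R α : ℝ) (w : ℝ → ℝ) (hp : 1 < p) (hR : 0 < R) (hα : α ≠ 0)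
    (hw : ContDiffOn ℝ ∞ w (Icc 0 R)) (hwpos : ∀ t ∈ Icc 0 R, 0 < w t) (hw0 : w 0 = 1) :
    -- the first eigenvalue and a positive first eigenfunction exist on `[0,r]`, `0 < r ≤ R`
    (∀ r : ℝ, 0 < r → r ≤ R →
      IsLeast (eigenvalues p r w α) (firstEigenvalue p r w α) ∧
      ∃ u : ℝ → ℝ, IsPositiveFirstEigenfunction p r w α u) ∧
    (∀ u : ℝ → ℝ, IsPositiveFirstEigenfunction p R w α u →
      -- the derivative exists everywhere on `[0,R]` (one-sided at the ends) and is continuous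
      ContDiffOn ℝ 1 u (Icc 0 R) ∧
      -- sign of the derivative
      (0 < α → ∀ t ∈ Ico 0 R, 0 < derivWithin u (Icc 0 R) t) ∧
      (α < 0 → ∀ t ∈ Ico 0 R, derivWithin u (Icc 0 R) t < 0) ∧
      -- the logarithmic derivative, for a strictly log-concave weight
      ((∀ t ∈ Ico 0 R, iteratedDerivWithin 2 (fun s => Real.log (w s)) (Icc 0 R) t < 0) →
        (0 < α →
          AntitoneOn (fun t => derivWithin u (Icc 0 R) t / u t) (Icc 0 R) ∧
          ∀ t ∈ Icc 0 R, |derivWithin u (Icc 0 R) t / u t| ^ (p - 1) ≤ α) ∧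
        (α < 0 →
          MonotoneOn (fun t => derivWithin u (Icc 0 R) t / u t) (Icc 0 R) ∧
          ∀ t ∈ Icc 0 R, |derivWithin u (Icc 0 R) t / u t| ^ (p - 1) ≤ -α))) ∧
    -- the first eigenvalue is strictly decreasing in the length of the interval
    (0 < α → ∀ R' : ℝ, 0 < R' → R' < R →
      firstEigenvalue p R w α < firstEigenvalue p R' w α) := by

  have hpq := Real.HolderConjugate.conjExponent hp
  have hwc := hw.continuousOn
  have hud := uniqueDiffOn_Icc hR
  have h0 : (0 : ℝ) ∈ Icc 0 R := ⟨le_rfl, hR.le⟩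
  have hres : ∀ r ≤ R, Icc 0 r ⊆ Icc 0 R := fun r hr => Icc_subset_Icc_right hr
  have hex := fun r hr (hrR : r ≤ R) => isLeast_firstEigenvalue_and_exists_pos (r := r) hp hr hα
    (hwc.mono (hres r hrR)) fun t ht => hwpos t (hres r hrR ht)
  refine ⟨hex, fun u ⟨hu, hupos⟩ => ?_, fun hα' R' hR' hlt => ?_⟩
  · obtain ⟨Y, hY0, hYR, hYp, hYn, hY, hder⟩ := hu.exists_riccati hpq hR hwc hwpos hupos
    have hYc : ContinuousOn Y (Icc 0 R) := fun t ht => (hY t ht).continuousWithinAt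
    have huc : ContinuousOn u (Icc 0 R) := fun t ht => (hder t ht).continuousWithinAt
    have hdw : ∀ t ∈ Icc 0 R,
        derivWithin u (Icc 0 R) t = u t * pPower p.conjExponent (Y t / w t) :=
      fun t ht => (hder t ht).derivWithin (hud t ht)
    have hratio : ∀ t ∈ Icc 0 R,
        derivWithin u (Icc 0 R) t / u t = pPower p.conjExponent (Y t / w t) := fun t ht => by
      rw [hdw t ht, mul_div_cancel_left₀ _ (hupos t ht).ne']
    have habs : ∀ t ∈ Icc 0 R,
        |derivWithin u (Icc 0 R) t / u t| ^ (p - 1) = |Y t / w t| := fun t ht => by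
      rw [hratio t ht, ← abs_pPower hp, pPower_pPower hpq.symm]
    have hmono := (pPower_strictMono hpq.symm.lt).monotone
    have hyd := fun t (ht : t ∈ Icc 0 R) =>
      hasDerivWithinAt_div_weight hR (hw.differentiableOn (by simp)) hwpos hY ht
    refine ⟨contDiffOn_one_of_hasDerivWithinAt hR hder (huc.mul
      ((continuous_pPower hpq.symm.lt).comp_continuousOn
        (hYc.div hwc fun t ht => (hwpos t ht).ne'))), fun hα' t ht => ?_, fun hα' t ht => ?_,
      fun hlog => ⟨fun hα' => ?_, fun hα' => ?_⟩⟩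
    · have htI := Ico_subset_Icc_self ht
      rw [hdw t htI]
      exact mul_pos (hupos t htI) (pPower_pos (div_pos (hYp hα' t ht) (hwpos t htI)))
    · have htI := Ico_subset_Icc_self ht
      rw [hdw t htI]
      have h := pPower_pos (p := p.conjExponent)
        (neg_pos.2 (div_neg_of_neg_of_pos (hYn hα' t ht) (hwpos t htI)))
      rw [pPower_neg] at h
      exact mul_neg_of_pos_of_neg (hupos t htI) (neg_pos.1 h)
    · have hnn : ∀ t ∈ Icc 0 R, 0 ≤ Y t / w t := fun t ht => by
        refine div_nonneg ?_ (hwpos t ht).le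
        rcases ht.2.lt_or_eq with h | rfl
        · exact (hYp hα' t ⟨ht.1, h⟩).le
        · exact hYR.ge
      have hanti : AntitoneOn (fun t => Y t / w t) (Icc 0 R) :=
        antitoneOn_of_hasDerivWithinAt_mul_add (G := fun z => -firstEigenvalue p R w α -
          (p - 1) * |z| ^ p.conjExponent) hyd hnn (by rw [hYR, zero_div])
          (strictMonoOn_neg_derivWithin_log hR hw hwpos hlog)
      refine ⟨fun a ha b hb hab => ?_, fun t ht => ?_⟩
      · simp only [hratio a ha, hratio b hb]
        exact hmono (hanti ha hb hab)
      · rw [habs t ht, abs_of_nonneg (hnn t ht)]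
        simpa [hY0, hw0] using hanti h0 ht ht.1
    · have hnn : ∀ t ∈ Icc 0 R, 0 ≤ -(Y t / w t) := fun t ht => by
        rw [← neg_div]
        refine div_nonneg ?_ (hwpos t ht).le
        rcases ht.2.lt_or_eq with h | rfl
        · exact neg_nonneg.2 (hYn hα' t ⟨ht.1, h⟩).le
        · rw [hYR, neg_zero]
      -- Reflecting `z` to `-z` keeps the increasing linear coefficient and only changes the sign of
      -- `G`, so the same crossing lemma applies.
      have hanti : AntitoneOn (fun t => -(Y t / w t)) (Icc 0 R) :=
        antitoneOn_of_hasDerivWithinAt_mul_add (G := fun z => firstEigenvalue p R w α +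
          (p - 1) * |z| ^ p.conjExponent) (fun t ht => by
            refine (hyd t ht).neg.congr_deriv ?_
            rw [abs_neg]
            ring) hnn (by rw [hYR, zero_div, neg_zero])
          (strictMonoOn_neg_derivWithin_log hR hw hwpos hlog)
      refine ⟨fun a ha b hb hab => ?_, fun t ht => ?_⟩
      · simp only [hratio a ha, hratio b hb]
        exact hmono (neg_le_neg_iff.1 (hanti ha hb hab))
      · rw [habs t ht, ← abs_neg, abs_of_nonneg (hnn t ht)]
        simpa [hY0, hw0] using hanti h0 ht ht.1
  · obtain ⟨-, u, hu, hupos⟩ := hex R hR le_rfl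
    obtain ⟨-, v, hv, hvpos⟩ := hex R' hR' hlt.le
    obtain ⟨Y, hY0, -, hYp, -, hY, -⟩ := hu.exists_riccati hpq hR hwc hwpos hupos
    have hsub := hres R' hlt.le
    -- The Riccati solution of `[0,R]` is still positive at the interior point `R'`.
    exact hv.lt_of_riccati hpq hR' (hwc.mono hsub) (fun t ht => hwpos t (hsub ht)) hY0
      (hYp hα' R' ⟨hR'.le, hlt⟩) (hvpos R' ⟨hR'.le, le_rfl⟩).ne'
      fun t ht => (hY t (hsub ht)).mono hsub
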